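/- Let $\mathbb{H}_1,\mathbb{H}_2$ be Hilbert spaces over the same scalar field $\mathbb{F}\in\{\mathbb{R},\mathbb{C}\}$, and let $T:\mathbb{H}_1\to\mathbb{H}_2$ be a bounded linear operator with $\|T\|=1$. Let $M_T=\{x\in\mathbb{H}_1:\|x\|=1,\ \|Tx\|=\|T\|\}$ be its norm attainment set. Suppose that there is a finite-dimensional subspace $H_0$ of $\mathbb{H}_1$ with $\dim H_0=n$ such that $M_T=\{x\in H_0:\|x\|=1\}$ and $\|T|_{H_0^\perp}\|<1$. Let $\mathbb{L}(\mathbb{H}_1,\mathbb{H}_2)$ be the space of all bounded linear operators with the operator norm, and let $$J(T)=\{f\in \mathbb{L}(\mathbb{H}_1,\mathbb{H}_2)^*:\ \|f\|=1,\ f(T)=1\}$$ be the set of supporting functionals of $T$, with set of extreme points $\mathrm{Ext}\,J(T)$. For $k\in\mathbb{N}$, the operator $T$ is called $k$-smooth if $\dim\operatorname{span}J(T)=\dim\operatorname{span}\mathrm{Ext}\,J(T)=k$, where spans and dimensions are over $\mathbb{F}$. Then $T$ is $n^2$-smooth if $\mathbb{F}=\mathbb{C}$, and $T$ is $\binom{n+1}{2}$-smooth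 if $\mathbb{F}=\mathbb{R}$. -/

import Mathlib

/-- The set `J(x)` of supporting linear functionals of a unit vector `x`. -/
def supportFunctionals (𝕜 : Type*) [RCLike 𝕜] {X : Type*} [NormedAddCommGroup X]
    [NormedSpace 𝕜 X] (x : X) : Set (StrongDual 𝕜 X) :=
  {f | ‖f‖ = 1 ∧ f x = 1}

/-- A point `x` of the unit sphere is `k`-smooth if `dim span J(x) = k`, the span and the
dimension being taken over the scalar field (and the dimension being a cardinal, so that an
infinite-dimensional span has no natural number as its dimension). -/
def IsKSmooth (𝕜 : Type*) [RCLike 𝕜] {X : Type*} [NormedAddCommGroup X]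
    [NormedSpace 𝕜 X] (k : ℕ) (x : X) : Prop :=
  ‖x‖ = 1 ∧ Module.rank 𝕜 (Submodule.span 𝕜 (supportFunctionals 𝕜 x)) = k

/-- A bounded operator `T` of norm one is `k`-smooth if
`k = dim span J(T) = dim span Ext J(T)`, where `J(T)` consists of functionals on the space of all
bounded operators with the operator norm, and `Ext` is the set of extreme points. -/
def IsKSmoothOperator (𝕜 : Type*) [RCLike 𝕜] {X Y : Type*}
    [NormedAddCommGroup X] [NormedSpace 𝕜 X] [NormedAddCommGroup Y] [NormedSpace 𝕜 Y]
    (k : ℕ) (T : X →L[𝕜] Y) : Prop :=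
  IsKSmooth 𝕜 k T ∧
    Module.rank 𝕜 (Submodule.span 𝕜 (Set.extremePoints ℝ (supportFunctionals 𝕜 T))) = k

/-- The norm attainment set `M_T`. -/
def normAttainmentSet {𝕜 : Type*} [RCLike 𝕜] {X Y : Type*}
    [NormedAddCommGroup X] [NormedSpace 𝕜 X] [NormedAddCommGroup Y] [NormedSpace 𝕜 Y]
    (T : X →L[𝕜] Y) : Set X :=
  {x | ‖x‖ = 1 ∧ ‖T x‖ = ‖T‖}

/-!
The span of `J(T)` is identified with the span of the functionals `S ↦ ⟪T x, S x⟫`, `x ∈ H₀`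
(`diagonalSpan T H₀`), and the dimension of the latter is read off from a basis.

Each `S ↦ ⟪T x, S x⟫` with `x` in the norm attainment set is a supporting functional. Conversely,
suppose that `⟪T x, S x⟫ = 0` for all `x ∈ H₀`. Since `T` is a contraction that is isometric on
`H₀`, it maps `H₀` and `H₀ᗮ` to orthogonal subspaces, and since moreover `‖T|H₀ᗮ‖ < 1`, the norm
`‖T + t • S‖` exceeds `1` only by a term of order `t ^ 2` (`norm_add_smul_sq_le`). A supporting
functional therefore vanishes at `S` (`apply_eq_zero_of_mem_supportFunctionals`). As
`diagonalSpan T H₀` is finite-dimensional, duality puts every supporting functional in it.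

The set `J(T)` is then compact and convex, so the Krein–Milman theorem shows that its extreme
points span the same space (`span_extremePoints_supportFunctionals`).

Let `e` be an orthonormal basis of `H₀`; the vectors `T (e i)` are again orthonormal. Over `ℂ`,
polarization shows that the `n ^ 2` functionals `S ↦ ⟪T (e i), S (e j)⟫` form a basis of
`diagonalSpan T H₀`. Over `ℝ` only the symmetric combinations
`S ↦ ⟪T (e i), S (e j)⟫ + ⟪T (e j), S (e i)⟫` occur; they are indexed by the unordered pairs of
indices, of which there are `(n + 1).choose 2`.
-/

open scoped InnerProductSpace

section General

variable {𝕜 : Type*} [RCLike 𝕜]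
  {E : Type*} [NormedAddCommGroup E] [InnerProductSpace 𝕜 E]
  {F : Type*} [NormedAddCommGroup F] [InnerProductSpace 𝕜 F]

/-! ### Supporting functionals -/

theorem convex_supportFunctionals {X : Type*} [NormedAddCommGroup X] [NormedSpace 𝕜 X]
    {x : X} (hx : ‖x‖ = 1) : Convex ℝ (supportFunctionals 𝕜 x) := by
  rintro f ⟨hf, hfx⟩ g ⟨hg, hgx⟩ a b ha hb hab
  have hval : (a • f + b • g) x = 1 := by
    simp only [add_apply, smul_apply, hfx, hgx]
    rw [← add_smul, hab, one_smul]
  refine ⟨le_antisymm ?_ ?_, hval⟩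
  · calc ‖a • f + b • g‖ ≤ ‖a • f‖ + ‖b • g‖ := norm_add_le _ _
      _ = 1 := by
        rw [norm_smul, norm_smul, hf, hg, Real.norm_of_nonneg ha, Real.norm_of_nonneg hb,
          mul_one, mul_one, hab]
  · simpa [hval, hx] using (a • f + b • g).le_opNorm x

theorem isClosed_supportFunctionals {X : Type*} [NormedAddCommGroup X] [NormedSpace 𝕜 X]
    (x : X) : IsClosed (supportFunctionals 𝕜 x) :=
  (isClosed_eq continuous_norm continuous_const).inter
    (isClosed_eq (ContinuousLinearMap.apply 𝕜 𝕜 x).continuous continuous_const)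

/-- When the supporting functionals span a finite-dimensional space they form a compact convex
set, so the Krein–Milman theorem applies to them. -/
theorem span_extremePoints_supportFunctionals {X : Type*} [NormedAddCommGroup X]
    [NormedSpace 𝕜 X] {x : X} (hx : ‖x‖ = 1)
    [FiniteDimensional 𝕜 (Submodule.span 𝕜 (supportFunctionals 𝕜 x))] :
    Submodule.span 𝕜 (Set.extremePoints ℝ (supportFunctionals 𝕜 x)) =
      Submodule.span 𝕜 (supportFunctionals 𝕜 x) := by
  set J := supportFunctionals 𝕜 x
  set W := Submodule.span 𝕜 J
  have hle : Submodule.span 𝕜 (Set.extremePoints ℝ J) ≤ W :=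
    Submodule.span_mono extremePoints_subset
  refine le_antisymm hle (Submodule.span_le.2 ?_)
  have hcomp : IsCompact J := by
    have : ProperSpace W := FiniteDimensional.proper_rclike 𝕜 W
    have hpre : IsCompact ((↑) ⁻¹' J : Set W) := by
      refine Metric.isCompact_of_isClosed_isBounded
        ((isClosed_supportFunctionals x).preimage continuous_subtype_val) ?_
      refine (Metric.isBounded_closedBall (x := (0 : W)) (r := 1)).subset fun f hf => ?_
      exact mem_closedBall_zero_iff.2 (show ‖(f : StrongDual 𝕜 X)‖ ≤ 1 from hf.1.le)
    have himage : ((↑) : W → StrongDual 𝕜 X) '' ((↑) ⁻¹' J) = J :=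
      Set.image_preimage_eq_of_subset fun f hf => ⟨⟨f, Submodule.subset_span hf⟩, rfl⟩
    exact himage ▸ hpre.image continuous_subtype_val
  have : FiniteDimensional 𝕜 (Submodule.span 𝕜 (Set.extremePoints ℝ J)) :=
    Submodule.finiteDimensional_of_le hle
  have hclosed : IsClosed
      (Submodule.span 𝕜 (Set.extremePoints ℝ J) : Set (StrongDual 𝕜 X)) :=
    Submodule.closed_of_finiteDimensional _
  have hKM := closure_convexHull_extremePoints hcomp (convex_supportFunctionals hx)
  calc J = closure (convexHull ℝ (Set.extremePoints ℝ J)) := hKM.symm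
    _ ⊆ _ := closure_minimal (convexHull_min Submodule.subset_span
      ((Submodule.span 𝕜 (Set.extremePoints ℝ J)).restrictScalars ℝ).convex) hclosed

/-- A supporting functional at `x` has vanishing real part along every direction `y` in which
the norm grows at most quadratically: a nonzero first-order term would beat the quadratic one. -/
theorem re_eq_zero_of_norm_sq_add_smul_le {X : Type*} [NormedAddCommGroup X] [NormedSpace 𝕜 X]
    {x y : X} {f : StrongDual 𝕜 X} (hf : f ∈ supportFunctionals 𝕜 x) {C δ : ℝ} (hδ : 0 < δ)
    (h : ∀ t : ℝ, |t| ≤ δ → ‖x + (t : 𝕜) • y‖ ^ 2 ≤ 1 + C * t ^ 2) :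
    RCLike.re (f y) = 0 := by
  obtain ⟨hf1, hfx⟩ := hf
  have key : ∀ t : ℝ, |t| ≤ δ → 2 * t * RCLike.re (f y) ≤ C * t ^ 2 := by
    intro t ht
    have h1 : RCLike.re (f (x + (t : 𝕜) • y)) = 1 + t * RCLike.re (f y) := by
      simp [hfx]
    have h2 : |RCLike.re (f (x + (t : 𝕜) • y))| ≤ ‖x + (t : 𝕜) • y‖ :=
      (RCLike.abs_re_le_norm _).trans (by simpa [hf1] using f.le_opNorm (x + (t : 𝕜) • y))
    have h3 := pow_le_pow_left₀ (abs_nonneg _) h2 2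
    rw [sq_abs, h1] at h3
    nlinarith [h t ht, sq_nonneg (t * RCLike.re (f y))]
  set r := RCLike.re (f y)
  have hC : 0 < |C| + 1 := by positivity
  by_contra hr
  have hr' : 0 < |r| := abs_pos.2 hr
  -- `s` is small enough that `|C| * s < 2 * |r|`; one of `t = s`, `t = -s` has the sign of `r`
  set s := min δ (|r| / (|C| + 1)) with hs
  have hs0 : 0 < s := lt_min hδ (by positivity)
  have hsr : s * (|C| + 1) ≤ |r| := (le_div_iff₀ hC).1 (min_le_right _ _)
  have hsδ : |s| ≤ δ := by rw [abs_of_pos hs0]; exact min_le_left _ _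
  have h1 := key s hsδ
  have h2 := key (-s) (by rwa [abs_neg])
  have h3 : 2 * s * |r| ≤ C * s ^ 2 := by
    rcases abs_cases r with ⟨h, _⟩ | ⟨h, _⟩ <;> rw [h] <;> nlinarith
  have h4 : 2 * |r| ≤ C * s := by
    have : s * (2 * |r|) ≤ s * (C * s) := by nlinarith
    exact le_of_mul_le_mul_left this hs0
  nlinarith [le_abs_self C, abs_nonneg C]

/-! ### The functionals `S ↦ ⟪T x, S y⟫` -/

/-- The functional `S ↦ ⟪T x, S y⟫` on the space of bounded operators. -/
noncomputable def innerFunctional (T : E →L[𝕜] F) (x y : E) : StrongDual 𝕜 (E →L[𝕜] F) :=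
  (innerSL 𝕜 (T x)).comp (ContinuousLinearMap.apply 𝕜 F y)

@[simp]
theorem innerFunctional_apply (T : E →L[𝕜] F) (x y : E) (S : E →L[𝕜] F) :
    innerFunctional T x y S = ⟪T x, S y⟫_𝕜 := rfl

/-- The span of the functionals `S ↦ ⟪T x, S x⟫` with `x` in `H₀`. -/
noncomputable def diagonalSpan (T : E →L[𝕜] F) (H₀ : Submodule 𝕜 E) :
    Submodule 𝕜 (StrongDual 𝕜 (E →L[𝕜] F)) :=
  Submodule.span 𝕜 ((fun x => innerFunctional T x x) '' (H₀ : Set E))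

theorem innerFunctional_self_mem_diagonalSpan (T : E →L[𝕜] F) {H₀ : Submodule 𝕜 E} {x : E}
    (hx : x ∈ H₀) : innerFunctional T x x ∈ diagonalSpan T H₀ :=
  Submodule.subset_span ⟨x, hx, rfl⟩

theorem innerFunctional_smul_smul (T : E →L[𝕜] F) (a b : 𝕜) (x y : E) :
    innerFunctional T (a • x) (b • y) = (starRingEnd 𝕜 a * b) • innerFunctional T x y := by
  ext S
  simp [inner_smul_left, inner_smul_right]
  ring

theorem innerFunctional_add_add (T : E →L[𝕜] F) (x y : E) :
    innerFunctional T (x + y) (x + y) = innerFunctional T x x + innerFunctional T y y +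
      (innerFunctional T x y + innerFunctional T y x) := by
  ext S
  simp [inner_add_left, inner_add_right]
  ring

theorem innerFunctional_sum_sum {ι : Type*} [Fintype ι] (T : E →L[𝕜] F) (c : ι → 𝕜)
    (e : ι → E) :
    innerFunctional T (∑ i, c i • e i) (∑ i, c i • e i) =
      ∑ i, ∑ j, (starRingEnd 𝕜 (c i) * c j) • innerFunctional T (e i) (e j) := by
  ext S
  simp only [innerFunctional_apply, map_sum, map_smul, sum_inner, inner_sum, inner_smul_left,
    inner_smul_right, sum_apply, smul_apply, smul_eq_mul]
  simp only [Finset.mul_sum, mul_left_comm, mul_assoc]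
  exact Finset.sum_comm

theorem innerFunctional_add_swap_mem_diagonalSpan (T : E →L[𝕜] F) {H₀ : Submodule 𝕜 E}
    {x y : E} (hx : x ∈ H₀) (hy : y ∈ H₀) :
    innerFunctional T x y + innerFunctional T y x ∈ diagonalSpan T H₀ := by
  have h := (diagonalSpan T H₀).sub_mem
    (innerFunctional_self_mem_diagonalSpan T (H₀.add_mem hx hy))
    ((diagonalSpan T H₀).add_mem (innerFunctional_self_mem_diagonalSpan T hx)
      (innerFunctional_self_mem_diagonalSpan T hy))
  rwa [innerFunctional_add_add, add_sub_cancel_left] at h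

/-! ### Operators attaining their norm on the unit sphere of a subspace -/

theorem norm_map_of_mem_of_normAttainmentSet {T : E →L[𝕜] F} {H₀ : Submodule 𝕜 E}
    (hT : ‖T‖ = 1) (hM : normAttainmentSet T = {x : E | x ∈ H₀ ∧ ‖x‖ = 1}) {x : E}
    (hx : x ∈ H₀) : ‖T x‖ = ‖x‖ := by
  rcases eq_or_ne x 0 with rfl | hx0
  · simp
  have hn : ‖x‖ ≠ 0 := norm_ne_zero_iff.2 hx0
  have hmem : ((‖x‖⁻¹ : ℝ) : 𝕜) • x ∈ normAttainmentSet T := by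
    rw [hM]
    refine ⟨H₀.smul_mem _ hx, ?_⟩
    simp [norm_smul, hn]
  have h := hmem.2
  rw [map_smul, norm_smul, hT] at h
  rw [RCLike.norm_ofReal, abs_inv, abs_norm] at h
  field_simp at h
  exact h

/-- A contraction preserves the inner product with any vector whose norm it preserves. -/
theorem inner_map_map_of_norm_map_eq [CompleteSpace E] [CompleteSpace F] {T : E →L[𝕜] F}
    (hT : ‖T‖ ≤ 1) {x : E} (hx : ‖T x‖ = ‖x‖) (y : E) : ⟪T x, T y⟫_𝕜 = ⟪x, y⟫_𝕜 := by
  have hfix : T.adjoint (T x) = x := by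
    rw [← sub_eq_zero, ← norm_eq_zero, ← sq_eq_zero_iff]
    refine le_antisymm ?_ (sq_nonneg _)
    have h1 : ‖T.adjoint (T x)‖ ≤ ‖x‖ := by
      rw [← hx]
      refine T.adjoint.le_of_opNorm_le (c := 1) ?_ (T x) |>.trans (by simp)
      simpa using hT
    have h2 : RCLike.re ⟪T.adjoint (T x), x⟫_𝕜 = ‖x‖ ^ 2 := by
      rw [ContinuousLinearMap.adjoint_inner_left, inner_self_eq_norm_sq, hx]
    rw [norm_sub_sq (𝕜 := 𝕜), h2]
    nlinarith [norm_nonneg (T.adjoint (T x)), norm_nonneg x]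
  rw [← ContinuousLinearMap.adjoint_inner_left, hfix]

/-- The elementary inequality behind the second-order bound on `‖T + t • S‖`: `a`, `b` are the
norms of the components of a vector in `H₀` and in `H₀ᗮ`, `c` is the norm of `T` on `H₀ᗮ` and
`u = |t| * ‖S‖`. -/
theorem sq_add_sq_add_le {a b c u : ℝ} (ha : 0 ≤ a) (hb : 0 ≤ b) (hc : 0 ≤ c) (hc1 : c < 1)
    (hu : 0 ≤ u) (huc : u ≤ (1 - c ^ 2) / 4) :
    a ^ 2 + (c * b + u * (a + b)) ^ 2 + 2 * u * (a * b) ≤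
      (1 + (2 + 8 / (1 - c ^ 2)) * u ^ 2) * (a ^ 2 + b ^ 2) := by
  have hd : 0 < 1 - c ^ 2 := by nlinarith
  set d := 1 - c ^ 2 with hd'
  have h1 : u ^ 2 * (a + b) ^ 2 ≤ 2 * u ^ 2 * (a ^ 2 + b ^ 2) := by
    nlinarith [mul_nonneg (sq_nonneg u) (sq_nonneg (a - b))]
  have h2 : 4 * u * (a * b) ≤ d / 2 * b ^ 2 + 8 / d * u ^ 2 * a ^ 2 := by
    have : d / 2 * b ^ 2 + 8 / d * u ^ 2 * a ^ 2 - 4 * u * (a * b) =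
        (d * b - 4 * u * a) ^ 2 / (2 * d) := by
      field_simp
      ring
    have h : 0 ≤ (d * b - 4 * u * a) ^ 2 / (2 * d) := by positivity
    linarith
  have h3 : 2 * c * u * b ^ 2 ≤ d / 2 * b ^ 2 := by
    refine mul_le_mul_of_nonneg_right ?_ (sq_nonneg b)
    nlinarith
  have h4 : 2 * c * u * (a * b) ≤ 2 * u * (a * b) := by
    refine mul_le_mul_of_nonneg_right ?_ (mul_nonneg ha hb)
    nlinarith
  have h5 : 0 ≤ 8 / d * u ^ 2 * b ^ 2 := by positivity
  have h6 : c ^ 2 = 1 - d := by rw [hd']; ring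
  have h7 : (c * b + u * (a + b)) ^ 2 =
      (1 - d) * b ^ 2 + 2 * c * u * (a * b) + 2 * c * u * b ^ 2 + u ^ 2 * (a + b) ^ 2 := by
    rw [← h6]; ring
  have h8 : (1 + (2 + 8 / d) * u ^ 2) * (a ^ 2 + b ^ 2) = a ^ 2 + b ^ 2 +
      2 * u ^ 2 * (a ^ 2 + b ^ 2) + 8 / d * u ^ 2 * a ^ 2 + 8 / d * u ^ 2 * b ^ 2 := by ring
  rw [h7, h8]
  linarith

/-- If the numerical values `⟪T x, S x⟫` have zero real part on `H₀`, then perturbing `T` in the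
direction `S` changes the norm only to second order. -/
theorem norm_add_smul_sq_le [CompleteSpace E] [CompleteSpace F] {T : E →L[𝕜] F}
    {H₀ : Submodule 𝕜 E} [H₀.HasOrthogonalProjection] (hT : ‖T‖ = 1)
    (hM : normAttainmentSet T = {x : E | x ∈ H₀ ∧ ‖x‖ = 1})
    (hc : ‖T.comp H₀ᗮ.subtypeL‖ < 1) {S : E →L[𝕜] F}
    (hS : ∀ x ∈ H₀, RCLike.re ⟪T x, S x⟫_𝕜 = 0) {t : ℝ}
    (ht : |t| * ‖S‖ ≤ (1 - ‖T.comp H₀ᗮ.subtypeL‖ ^ 2) / 4) :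
    ‖T + (t : 𝕜) • S‖ ^ 2 ≤
      1 + (2 + 8 / (1 - ‖T.comp H₀ᗮ.subtypeL‖ ^ 2)) * (|t| * ‖S‖) ^ 2 := by
  set c := ‖T.comp H₀ᗮ.subtypeL‖ with hc'
  have hd : 0 < 1 - c ^ 2 := by nlinarith [norm_nonneg (T.comp H₀ᗮ.subtypeL)]
  set K := 1 + (2 + 8 / (1 - c ^ 2)) * (|t| * ‖S‖) ^ 2 with hK
  have hK0 : 0 ≤ K := by positivity
  suffices h : ‖T + (t : 𝕜) • S‖ ≤ √K by
    calc ‖T + (t : 𝕜) • S‖ ^ 2 ≤ √K ^ 2 := by gcongr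
      _ = K := Real.sq_sqrt hK0
  refine ContinuousLinearMap.opNorm_le_bound _ (Real.sqrt_nonneg _) fun z => ?_
  refine abs_le_of_sq_le_sq' ?_ (by positivity) |>.2
  rw [mul_pow, Real.sq_sqrt hK0]
  obtain ⟨x, hx, y, hy, rfl⟩ := H₀.exists_add_mem_mem_orthogonal z
  have hxy : ⟪x, y⟫_𝕜 = 0 := H₀.inner_right_of_mem_orthogonal hx hy
  have hTx : ‖T x‖ = ‖x‖ := norm_map_of_mem_of_normAttainmentSet hT hM hx
  have hTxy : ⟪T x, T y⟫_𝕜 = 0 := by rw [inner_map_map_of_norm_map_eq hT.le hTx, hxy]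
  have hpyth : ‖x + y‖ ^ 2 = ‖x‖ ^ 2 + ‖y‖ ^ 2 := by
    rw [norm_add_sq (𝕜 := 𝕜), hxy]; simp
  have hTy : ‖T y‖ ≤ c * ‖y‖ := (T.comp H₀ᗮ.subtypeL).le_opNorm ⟨y, hy⟩
  have hsplit : (T + (t : 𝕜) • S) (x + y) = T x + (T y + (t : 𝕜) • S (x + y)) := by
    simp [add_assoc]
  have hcross : RCLike.re ⟪T x, T y + (t : 𝕜) • S (x + y)⟫_𝕜 ≤
      (|t| * ‖S‖) * (‖x‖ * ‖y‖) := by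
    have : RCLike.re ⟪T x, T y + (t : 𝕜) • S (x + y)⟫_𝕜 = t * RCLike.re ⟪T x, S y⟫_𝕜 := by
      rw [inner_add_right, hTxy, inner_smul_right, zero_add, RCLike.re_ofReal_mul, map_add,
        inner_add_right, map_add, hS x hx, zero_add]
    rw [this]
    calc t * RCLike.re ⟪T x, S y⟫_𝕜 ≤ |t| * |RCLike.re ⟪T x, S y⟫_𝕜| := by
          rw [← abs_mul]; exact le_abs_self _
      _ ≤ |t| * (‖T x‖ * ‖S y‖) := by
          gcongr
          exact (RCLike.abs_re_le_norm _).trans (norm_inner_le_norm _ _)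
      _ ≤ |t| * (‖x‖ * (‖S‖ * ‖y‖)) := by
          rw [hTx]
          gcongr
          exact S.le_opNorm y
      _ = _ := by ring
  have hrest : ‖T y + (t : 𝕜) • S (x + y)‖ ≤ c * ‖y‖ + (|t| * ‖S‖) * (‖x‖ + ‖y‖) := by
    refine (norm_add_le _ _).trans (add_le_add hTy ?_)
    rw [norm_smul, RCLike.norm_ofReal, mul_assoc]
    gcongr
    exact (S.le_opNorm _).trans (by gcongr; exact norm_add_le _ _)
  have hrest2 : ‖T y + (t : 𝕜) • S (x + y)‖ ^ 2 ≤
      (c * ‖y‖ + (|t| * ‖S‖) * (‖x‖ + ‖y‖)) ^ 2 := by gcongr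
  rw [hsplit, norm_add_sq (𝕜 := 𝕜), hTx, hpyth]
  have := sq_add_sq_add_le (norm_nonneg x) (norm_nonneg y) (norm_nonneg _) hc
    (by positivity : 0 ≤ |t| * ‖S‖) ht
  linarith

/-- A supporting functional of `T` vanishes wherever all the functionals `S ↦ ⟪T x, S x⟫`,
`x ∈ H₀`, vanish. -/
theorem apply_eq_zero_of_mem_supportFunctionals [CompleteSpace E] [CompleteSpace F]
    {T : E →L[𝕜] F} {H₀ : Submodule 𝕜 E} [H₀.HasOrthogonalProjection] (hT : ‖T‖ = 1)
    (hM : normAttainmentSet T = {x : E | x ∈ H₀ ∧ ‖x‖ = 1})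
    (hc : ‖T.comp H₀ᗮ.subtypeL‖ < 1) {f : StrongDual 𝕜 (E →L[𝕜] F)}
    (hf : f ∈ supportFunctionals 𝕜 T) {S : E →L[𝕜] F}
    (hS : ∀ x ∈ H₀, ⟪T x, S x⟫_𝕜 = 0) : f S = 0 := by
  have key : ∀ R : E →L[𝕜] F, (∀ x ∈ H₀, ⟪T x, R x⟫_𝕜 = 0) → RCLike.re (f R) = 0 := by
    intro R hR
    have hd : 0 < 1 - ‖T.comp H₀ᗮ.subtypeL‖ ^ 2 := by
      nlinarith [norm_nonneg (T.comp H₀ᗮ.subtypeL)]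
    set d := 1 - ‖T.comp H₀ᗮ.subtypeL‖ ^ 2 with hd'
    refine re_eq_zero_of_norm_sq_add_smul_le hf (C := (2 + 8 / d) * ‖R‖ ^ 2)
      (δ := d / 4 / (‖R‖ + 1)) (by positivity) fun t ht => ?_
    have ht' : |t| * ‖R‖ ≤ d / 4 := by
      rw [le_div_iff₀ (by positivity)] at ht
      nlinarith [abs_nonneg t]
    have h := norm_add_smul_sq_le hT hM hc (fun x hx => by rw [hR x hx, map_zero]) ht'
    rwa [mul_pow, sq_abs, mul_comm (t ^ 2), ← mul_assoc] at h
  -- multiplying `S` by the conjugate of `f S` makes the value real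
  have h := key (starRingEnd 𝕜 (f S) • S) fun x hx => by
    simp [inner_smul_right, hS x hx]
  rw [map_smul, smul_eq_mul, RCLike.conj_mul, ← RCLike.ofReal_pow, RCLike.ofReal_re] at h
  exact norm_eq_zero.1 (pow_eq_zero_iff two_ne_zero |>.1 h)

theorem innerFunctional_mem_supportFunctionals {T : E →L[𝕜] F} (hT : ‖T‖ = 1) {x : E}
    (hx : x ∈ normAttainmentSet T) : innerFunctional T x x ∈ supportFunctionals 𝕜 T := by
  obtain ⟨hx1, hTx⟩ := hx
  rw [hT] at hTx
  have hval : innerFunctional T x x T = 1 := by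
    rw [innerFunctional_apply, inner_self_eq_norm_sq_to_K, hTx]
    simp
  refine ⟨le_antisymm ?_ ?_, hval⟩
  · refine ContinuousLinearMap.opNorm_le_bound _ zero_le_one fun S => ?_
    calc ‖innerFunctional T x x S‖ ≤ ‖T x‖ * ‖S x‖ := norm_inner_le_norm _ _
      _ ≤ 1 * ‖S‖ := by
        rw [hTx]
        gcongr
        simpa [hx1] using S.le_opNorm x
  · simpa [hval, hT] using (innerFunctional T x x).le_opNorm T

theorem diagonalSpan_le_span_supportFunctionals {T : E →L[𝕜] F} {H₀ : Submodule 𝕜 E}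
    (hT : ‖T‖ = 1) (hM : normAttainmentSet T = {x : E | x ∈ H₀ ∧ ‖x‖ = 1}) :
    diagonalSpan T H₀ ≤ Submodule.span 𝕜 (supportFunctionals 𝕜 T) := by
  refine Submodule.span_le.2 ?_
  rintro _ ⟨x, hx, rfl⟩
  change innerFunctional T x x ∈ _
  rcases eq_or_ne x 0 with rfl | hx0
  · have : innerFunctional T (0 : E) 0 = 0 := by ext S; simp
    rw [this]
    exact zero_mem _
  have hn : ((‖x‖ : ℝ) : 𝕜) ≠ 0 := by simpa using hx0
  have hmem : ((‖x‖ : ℝ) : 𝕜)⁻¹ • x ∈ normAttainmentSet T := by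
    rw [hM]
    refine ⟨H₀.smul_mem _ hx, ?_⟩
    simp [norm_smul, hx0]
  have h := Submodule.smul_mem _ (starRingEnd 𝕜 (‖x‖ : 𝕜) * ‖x‖)
    (Submodule.subset_span (R := 𝕜) (innerFunctional_mem_supportFunctionals hT hmem))
  rwa [← innerFunctional_smul_smul, smul_inv_smul₀ hn] at h

/-- Any basis of `diagonalSpan T H₀` computes the order of smoothness of `T`. -/
theorem isKSmoothOperator_of_span_eq_diagonalSpan [CompleteSpace E] [CompleteSpace F]
    {T : E →L[𝕜] F} {H₀ : Submodule 𝕜 E} [H₀.HasOrthogonalProjection] (hT : ‖T‖ = 1)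
    (hM : normAttainmentSet T = {x : E | x ∈ H₀ ∧ ‖x‖ = 1})
    (hc : ‖T.comp H₀ᗮ.subtypeL‖ < 1) {ι : Type*} [Fintype ι]
    {ψ : ι → StrongDual 𝕜 (E →L[𝕜] F)} (hψ : LinearIndependent 𝕜 ψ)
    (hspan : Submodule.span 𝕜 (Set.range ψ) = diagonalSpan T H₀) :
    IsKSmoothOperator 𝕜 (Fintype.card ι) T := by
  have hJ : Submodule.span 𝕜 (supportFunctionals 𝕜 T) = Submodule.span 𝕜 (Set.range ψ) := by
    refine le_antisymm (Submodule.span_le.2 fun f hf => ?_)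
      (hspan.trans_le (diagonalSpan_le_span_supportFunctionals hT hM))
    have hker : ⨅ i, (ψ i : (E →L[𝕜] F) →ₗ[𝕜] 𝕜).ker ≤
        (f : (E →L[𝕜] F) →ₗ[𝕜] 𝕜).ker := by
      intro S hS
      have hS' : ∀ i, ψ i S = 0 := fun i => (Submodule.mem_iInf _).1 hS i
      have hle : Submodule.span 𝕜 (Set.range ψ) ≤
          (ContinuousLinearMap.apply 𝕜 𝕜 S :
            StrongDual 𝕜 (E →L[𝕜] F) →L[𝕜] 𝕜).toLinearMap.ker := by
        refine Submodule.span_le.2 ?_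
        rintro _ ⟨i, rfl⟩
        exact hS' i
      refine apply_eq_zero_of_mem_supportFunctionals hT hM hc hf fun x hx => ?_
      exact hle (hspan ▸ innerFunctional_self_mem_diagonalSpan T hx)
    obtain ⟨a, ha⟩ := (Submodule.mem_span_range_iff_exists_fun 𝕜).1
      (mem_span_of_iInf_ker_le_ker hker)
    refine (Submodule.mem_span_range_iff_exists_fun 𝕜).2 ⟨a, ?_⟩
    ext S
    simpa using LinearMap.congr_fun ha S
  have : FiniteDimensional 𝕜 (Submodule.span 𝕜 (Set.range ψ)) :=
    FiniteDimensional.span_of_finite 𝕜 (Set.finite_range ψ)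
  have hrank : Module.rank 𝕜 (Submodule.span 𝕜 (supportFunctionals 𝕜 T)) =
      (Fintype.card ι : ℕ) := by
    rw [hJ, ← Module.finrank_eq_rank, finrank_span_eq_card hψ]
  have : FiniteDimensional 𝕜 (Submodule.span 𝕜 (supportFunctionals 𝕜 T)) := by
    rw [hJ]; infer_instance
  refine ⟨⟨hT, hrank⟩, ?_⟩
  rw [span_extremePoints_supportFunctionals hT, hrank]

/-! ### Bases of the span of the diagonal functionals -/

section Basis

variable {ι : Type*} {H₀ : Submodule 𝕜 E}

/-- On the rank-one operator `v ↦ ⟪e l, v⟫ • T (e k)` the functional indexed by `(i, j)` is the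
Kronecker delta of `(i, j)` and `(k, l)`. -/
theorem innerFunctional_apply_rankOne [DecidableEq ι] {T : E →L[𝕜] F} {e : ι → E}
    (he : Orthonormal 𝕜 e) (hTe : Orthonormal 𝕜 (fun i => T (e i))) (i j k l : ι) :
    innerFunctional T (e i) (e j) ((innerSL 𝕜 (e l)).smulRight (T (e k))) =
      (if l = j then 1 else 0) * (if i = k then 1 else 0) := by
  rw [innerFunctional_apply, ContinuousLinearMap.smulRight_apply, inner_smul_right,
    innerSL_apply_apply, orthonormal_iff_ite.1 he, orthonormal_iff_ite.1 hTe]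

theorem diagonalSpan_le_of_orthonormalBasis [Fintype ι] (T : E →L[𝕜] F)
    (e : OrthonormalBasis ι 𝕜 H₀)
    {W : Submodule 𝕜 (StrongDual 𝕜 (E →L[𝕜] F))}
    (hW : ∀ c : ι → 𝕜, ∑ i, ∑ j, (starRingEnd 𝕜 (c i) * c j) •
      innerFunctional T (e i : E) (e j) ∈ W) : diagonalSpan T H₀ ≤ W := by
  refine Submodule.span_le.2 ?_
  rintro _ ⟨x, hx, rfl⟩
  have hsum : x = ∑ i, e.repr ⟨x, hx⟩ i • (e i : E) := by
    have := congrArg (Subtype.val) (e.sum_repr ⟨x, hx⟩)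
    simpa using this.symm
  change innerFunctional T x x ∈ W
  rw [hsum, innerFunctional_sum_sum]
  exact hW _

end Basis

end General

theorem complex_basis_diagonalSpan {E F : Type*} [NormedAddCommGroup E] [InnerProductSpace ℂ E]
    [NormedAddCommGroup F] [InnerProductSpace ℂ F] {ι : Type*} [Fintype ι] [DecidableEq ι]
    {T : E →L[ℂ] F} {H₀ : Submodule ℂ E} (e : OrthonormalBasis ι ℂ H₀)
    (hTe : Orthonormal ℂ (fun i => T (e i : E))) :
    LinearIndependent ℂ (fun p : ι × ι => innerFunctional T (e p.1 : E) (e p.2)) ∧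
      Submodule.span ℂ (Set.range fun p : ι × ι => innerFunctional T (e p.1 : E) (e p.2)) =
        diagonalSpan T H₀ := by
  have he : Orthonormal ℂ (fun i => (e i : E)) :=
    e.orthonormal.comp_linearIsometry H₀.subtypeₗᵢ
  refine ⟨?_, le_antisymm (Submodule.span_le.2 ?_) ?_⟩
  · rw [Fintype.linearIndependent_iff]
    rintro g hg ⟨k, l⟩
    have h := congrArg (fun f => f ((innerSL ℂ (e l : E)).smulRight (T (e k)))) hg
    simpa [-innerFunctional_apply, innerFunctional_apply_rankOne he hTe, Fintype.sum_prod_type,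
      sum_apply] using h
  · rintro _ ⟨⟨i, j⟩, rfl⟩
    change innerFunctional T (e i : E) (e j) ∈ _
    have h1 := innerFunctional_add_swap_mem_diagonalSpan T (e i).2 (e j).2
    have h2 := innerFunctional_add_swap_mem_diagonalSpan T (e i).2
      (H₀.smul_mem Complex.I (e j).2)
    -- polarization: the second symmetrised functional is `I • (φ i j - φ j i)`
    have h := (diagonalSpan T H₀).smul_mem (1 / 2 : ℂ)
      ((diagonalSpan T H₀).sub_mem h1 ((diagonalSpan T H₀).smul_mem Complex.I h2))
    refine (congrArg (· ∈ diagonalSpan T H₀) ?_).mpr h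
    ext S
    simp only [innerFunctional_apply, smul_apply,
      sub_apply, add_apply, map_smul, inner_smul_left,
      inner_smul_right, Complex.conj_I, smul_eq_mul]
    linear_combination (⟪T (e i : E), S (e j)⟫_ℂ - ⟪T (e j : E), S (e i)⟫_ℂ) / 2 *
      Complex.I_mul_I
  · refine diagonalSpan_le_of_orthonormalBasis T e fun c => ?_
    exact Submodule.sum_mem _ fun i _ => Submodule.sum_mem _ fun j _ =>
      Submodule.smul_mem _ _ (Submodule.subset_span ⟨(i, j), rfl⟩)

/-- The functional `S ↦ ⟪T x, S y⟫ + ⟪T y, S x⟫` attached to an unordered pair of vectors of a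
family `e`. -/
noncomputable def symmInnerFunctional {𝕜 E F : Type*} [RCLike 𝕜] [NormedAddCommGroup E]
    [InnerProductSpace 𝕜 E] [NormedAddCommGroup F] [InnerProductSpace 𝕜 F] {ι : Type*}
    (T : E →L[𝕜] F) (e : ι → E) : Sym2 ι → StrongDual 𝕜 (E →L[𝕜] F) :=
  Sym2.lift ⟨fun i j => innerFunctional T (e i) (e j) + innerFunctional T (e j) (e i),
    fun _ _ => add_comm _ _⟩

theorem symmInnerFunctional_mk {𝕜 E F : Type*} [RCLike 𝕜] [NormedAddCommGroup E]
    [InnerProductSpace 𝕜 E] [NormedAddCommGroup F] [InnerProductSpace 𝕜 F] {ι : Type*}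
    (T : E →L[𝕜] F) (e : ι → E) (i j : ι) : symmInnerFunctional T e s(i, j) =
      innerFunctional T (e i) (e j) + innerFunctional T (e j) (e i) := rfl

theorem real_basis_diagonalSpan {E F : Type*} [NormedAddCommGroup E] [InnerProductSpace ℝ E]
    [NormedAddCommGroup F] [InnerProductSpace ℝ F] {ι : Type*} [Fintype ι] [DecidableEq ι]
    {T : E →L[ℝ] F} {H₀ : Submodule ℝ E} (e : OrthonormalBasis ι ℝ H₀)
    (hTe : Orthonormal ℝ (fun i => T (e i : E))) :
    LinearIndependent ℝ (symmInnerFunctional T fun i => (e i : E)) ∧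
      Submodule.span ℝ (Set.range (symmInnerFunctional T fun i => (e i : E))) =
        diagonalSpan T H₀ := by
  have he : Orthonormal ℝ (fun i => (e i : E)) :=
    e.orthonormal.comp_linearIsometry H₀.subtypeₗᵢ
  refine ⟨?_, le_antisymm (Submodule.span_le.2 ?_) ?_⟩
  · rw [Fintype.linearIndependent_iff]
    intro g hg z
    induction z using Sym2.ind with | _ k l => ?_
    set R := (innerSL ℝ (e l : E)).smulRight (T (e k)) with hR
    have h : ∑ w, g w * symmInnerFunctional T (fun i => (e i : E)) w R = 0 := by
      simpa [sum_apply] using congrArg (fun f => f R) hg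
    rw [Finset.sum_eq_single s(k, l)] at h
    · refine (mul_eq_zero.1 h).resolve_right ?_
      rw [symmInnerFunctional_mk, add_apply, hR,
        innerFunctional_apply_rankOne he hTe, innerFunctional_apply_rankOne he hTe]
      -- the value is `1` for `k ≠ l` and `2` for `k = l`
      by_cases hkl : k = l
      · subst hkl; norm_num
      · simp [Ne.symm hkl]
    · intro w _ hw
      induction w using Sym2.ind with | _ i j => ?_
      rw [symmInnerFunctional_mk, add_apply, hR,
        innerFunctional_apply_rankOne he hTe, innerFunctional_apply_rankOne he hTe]
      rw [Ne, Sym2.eq_iff] at hw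
      grind
    · simp
  · rintro _ ⟨z, rfl⟩
    induction z using Sym2.ind with | _ i j => ?_
    exact innerFunctional_add_swap_mem_diagonalSpan T (e i).2 (e j).2
  · refine diagonalSpan_le_of_orthonormalBasis T e fun c => ?_
    -- the coefficients are symmetric, so the double sum equals its symmetrisation
    have hswap : ∑ i, ∑ j, (c i * c j) • innerFunctional T (e j : E) (e i) =
        ∑ i, ∑ j, (c i * c j) • innerFunctional T (e i : E) (e j) := by
      rw [Finset.sum_comm]
      exact Finset.sum_congr rfl fun i _ => Finset.sum_congr rfl fun j _ => by rw [mul_comm]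
    have hsymm : ∑ i, ∑ j, (starRingEnd ℝ (c i) * c j) • innerFunctional T (e i : E) (e j) =
        (1 / 2 : ℝ) • ∑ i, ∑ j, (c i * c j) •
          symmInnerFunctional T (fun i => (e i : E)) s(i, j) := by
      simp only [symmInnerFunctional_mk, smul_add, Finset.sum_add_distrib, conj_trivial]
      rw [hswap, ← two_smul ℝ, smul_smul]
      norm_num
    rw [hsymm]
    exact Submodule.smul_mem _ _ (Submodule.sum_mem _ fun i _ => Submodule.sum_mem _ fun j _ =>
      Submodule.smul_mem _ _ (Submodule.subset_span ⟨s(i, j), rfl⟩))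

/-! ### The order of smoothness -/

theorem orthonormal_map_orthonormalBasis {𝕜 E F : Type*} [RCLike 𝕜] [NormedAddCommGroup E]
    [InnerProductSpace 𝕜 E] [CompleteSpace E] [NormedAddCommGroup F] [InnerProductSpace 𝕜 F]
    [CompleteSpace F] {T : E →L[𝕜] F} {H₀ : Submodule 𝕜 E} (hT : ‖T‖ = 1)
    (hM : normAttainmentSet T = {x : E | x ∈ H₀ ∧ ‖x‖ = 1}) {ι : Type*} [Fintype ι]
    (e : OrthonormalBasis ι 𝕜 H₀) : Orthonormal 𝕜 (fun i => T (e i : E)) := by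
  classical
  rw [orthonormal_iff_ite]
  intro i j
  rw [inner_map_map_of_norm_map_eq hT.le
    (norm_map_of_mem_of_normAttainmentSet hT hM (e i).2), ← Submodule.coe_inner]
  exact orthonormal_iff_ite.1 e.orthonormal i j

theorem mainTheorem2 :
    (∀ (H₁ : Type*) [NormedAddCommGroup H₁] [InnerProductSpace ℂ H₁] [CompleteSpace H₁]
        (H₂ : Type*) [NormedAddCommGroup H₂] [InnerProductSpace ℂ H₂] [CompleteSpace H₂]
        (T : H₁ →L[ℂ] H₂) (H₀ : Submodule ℂ H₁) (n : ℕ),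
        ‖T‖ = 1 → FiniteDimensional ℂ H₀ → Module.finrank ℂ H₀ = n →
        normAttainmentSet T = {x : H₁ | x ∈ H₀ ∧ ‖x‖ = 1} →
        ‖T.comp H₀ᗮ.subtypeL‖ < 1 →
        IsKSmoothOperator ℂ (n ^ 2) T) ∧
    (∀ (H₁ : Type*) [NormedAddCommGroup H₁] [InnerProductSpace ℝ H₁] [CompleteSpace H₁]
        (H₂ : Type*) [NormedAddCommGroup H₂] [InnerProductSpace ℝ H₂] [CompleteSpace H₂]
        (T : H₁ →L[ℝ] H₂) (H₀ : Submodule ℝ H₁) (n : ℕ),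
        ‖T‖ = 1 → FiniteDimensional ℝ H₀ → Module.finrank ℝ H₀ = n →
        normAttainmentSet T = {x : H₁ | x ∈ H₀ ∧ ‖x‖ = 1} →
        ‖T.comp H₀ᗮ.subtypeL‖ < 1 →
        IsKSmoothOperator ℝ ((n + 1).choose 2) T) := by
  constructor
  · intro H₁ _ _ _ H₂ _ _ _ T H₀ n hT hfin hn hM hc
    subst hn
    have e := stdOrthonormalBasis ℂ H₀
    obtain ⟨hli, hspan⟩ := complex_basis_diagonalSpan e (orthonormal_map_orthonormalBasis hT hM e)
    have h := isKSmoothOperator_of_span_eq_diagonalSpan hT hM hc hli hspan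
    rwa [Fintype.card_prod, Fintype.card_fin, ← sq] at h
  · intro H₁ _ _ _ H₂ _ _ _ T H₀ n hT hfin hn hM hc
    subst hn
    have e := stdOrthonormalBasis ℝ H₀
    obtain ⟨hli, hspan⟩ := real_basis_diagonalSpan e (orthonormal_map_orthonormalBasis hT hM e)
    have h := isKSmoothOperator_of_span_eq_diagonalSpan hT hM hc hli hspan
    rwa [Sym2.card, Fintype.card_fin] at h
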